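/- Let $G$ be a finite or countable alphabet. A history is a sequence $\mathbf w=(w_{-1},w_{-2},\dots)$ of letters of $G$. Let $p(g|\mathbf w)\ge 0$ be a kernel: $p(g|\cdot)$ is measurable for the product $\sigma$-algebra, for every $g\in G$, and $\sum_{g\in G}p(g|\mathbf w)=1$ for every history $\mathbf w$. *Admissible histories.* Words are written with the most recent letter first, and forbidden words are defined recursively: the empty word is not forbidden, and $(s_0,s_{-1},\dots,s_{-n})$ is forbidden if $(s_{-1},\dots,s_{-n})$ is forbidden or if $p(s_0|\mathbf w)=0$ for all histories $\mathbf w$ with $(w_{-1},\dots,w_{-n})=(s_{-1},\dots,s_{-n})$. Let $\mathcal H$ be the set of histories $\mathbf w$ such that no word $(w_{-1},\dots,w_{-n})$, $n\ge1$, is forbidden. Assume $\mathcal H\neq\emptyset$ and fix $\mathbf g\in\mathcal H$. Let $G_{\mathcal H}=\{w_{-1}:\mathbf w\in\mathcal H\}$. *Maximal coupling function.* For $k\ge 0$, $g\in G$ and $\mathbf w\in\mathcal H$ put $$a_k(g|\mathbf w)=\inf\{p(g|\mathbf z):\mathbf z\in\mathcal H,\ z_{-i}=w_{-i}\text{ for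 }1\le i\le k\},\qquad a_k(\mathbf w)=\sum_{g\in G}a_k(g|\mathbf w),\qquad a_k=\inf_{\mathbf w\in\mathcal H}a_k(\mathbf w),$$ and $b_k(g|\mathbf w)=a_k(g|\mathbf w)-a_{k-1}(g|\mathbf w)$, where $a_{-1}(g|\cdot)=a_{-1}(\cdot)=0$. Let $f:[0,1)\times\mathcal H\to G$ be a maximal coupling function for $p$: for all $k\ge0$ and $\mathbf w\in\mathcal H$ the interval $[a_{k-1}(\mathbf w),a_k(\mathbf w))$ is partitioned into half-open subintervals $B_k(g|w_{-1},\dots,w_{-k})$, $g\in G$, of length $b_k(g|\mathbf w)$, depending on $\mathbf w$ only through $w_{-1},\dots,w_{-k}$, and $f(u|\mathbf w)=g$ for $u\in\bigcup_{k\ge0}B_k(g|w_{-1},\dots,w_{-k})$. Its iterates are $f^{(1)}=f$ and $$f^{(n+1)}(u_n,\dots,u_0|\mathbf w)=f\big(u_n\,\big|\,f^{(n)}(u_{n-1},\dots,u_0|\mathbf w),\dots,f^{(1)}(u_0|\mathbf w),\mathbf w\big).$$ *Markov regime.* Assume $a_1>0$ ($a_0$ may be $0$). For $u\in[0,1)$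 and $x\in G_{\mathcal H}$ let $\tilde f(u|x)=f(a_1u|\mathbf w)$ for any $\mathbf w\in\mathcal H$ with $w_{-1}=x$ (the value does not depend on the choice of $\mathbf w$); let $\tilde f^{(1)}=\tilde f$ and $\tilde f^{(n)}(u_n,\dots,u_1|x)=\tilde f(u_n|\tilde f^{(n-1)}(u_{n-1},\dots,u_1|x))$. For $n\ge1$ let $E_n$ be the set of $(u_0,u_{-1},\dots,u_{-n+1})\in[0,1)^n$ for which $\tilde f^{(n)}(u_0,\dots,u_{-n+1}|x)$ takes the same value for all $x\in G_{\mathcal H}$. *The time $\tau_0$.* Let $(U_i)_{i\in\mathbb Z}$ be i.i.d. random variables, uniformly distributed in $[0,1)$. With $K(u)=\inf\{k\in\mathbb N:a_k>u\}$ (and $\inf\emptyset=\infty$, $\sup\emptyset=-\infty$) define $$\tau_0=\sup\Big\{m<0:\ \exists\, l\in[m,0]\text{ such that } a_1^{-1}(U_l,\dots,U_m)\in E_{l-m+1}\text{ and }K(U_j)\le j-l\text{ for all integers }l<j\le0\Big\},$$ where $m$ and $l$ are integers. **Theorem.** Assume that (i) $\displaystyle\sum_{n=1}^\infty\prod_{m=1}^n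 a_m=\infty$; (ii) there is an integer $s\ge1$ such that $P\big((U_{s-1},\dots,U_0)\in E_s\big)>0$. Then $\tau_0$ is a.s. finite, and it is a backward coalescence time for $f$. That is: $\tau_0\le 0$; $\tau_0>-\infty$ a.s.; $\{\tau_0=-l\}\in\sigma(U_{-l},\dots,U_0)$ for every $l\in\mathbb N$; and whenever $\tau_0=-l$, $$f^{(l+1)}(U_0,\dots,U_{-l}|\mathbf w)=f^{(l+1)}(U_0,\dots,U_{-l}|\mathbf g)\qquad\text{for every }\mathbf w\in\mathcal H.$$ -/

import Mathlib

open MeasureTheory ProbabilityTheory Filter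

namespace InfiniteMemory

noncomputable section

/-- A transition kernel with infinite memory on the alphabet `G`.
A history `w = (w_{-1}, w_{-2}, …)` is encoded as a function `w : ℕ → G`, the value `w k`
being the letter `w_{-(k+1)}`; `prob g w` is `p(g | w)`. -/
structure HistoryKernel (G : Type*) [MeasurableSpace G] where
  prob : G → (ℕ → G) → ℝ
  nonneg : ∀ g w, 0 ≤ prob g w
  hasSum_one : ∀ w, HasSum (fun g => prob g w) 1
  measurable_prob : ∀ g, Measurable (prob g)

/-- The word `(w_{-1}, …, w_{-n})`, most recent letter first. -/
def histPrefix {G : Type*} (w : ℕ → G) (n : ℕ) : List G :=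
  List.ofFn (fun i : Fin n => w i)

/-- The history `(g, w)` obtained by adding the most recent letter `g` to `w`. -/
def histCons {G : Type*} (g : G) (w : ℕ → G) : ℕ → G
  | 0 => g
  | k + 1 => w k

section Kernel

variable {G : Type*} [MeasurableSpace G] (p : HistoryKernel G)

/-- Forbidden words (most recent letter first), by recursion on the length. -/
def Forbidden : List G → Prop
  | [] => False
  | s :: t => Forbidden t ∨ ∀ w : ℕ → G, histPrefix w t.length = t → p.prob s w = 0

/-- The set `ℋ` of admissible histories. -/
def admissible : Set (ℕ → G) :=
  {w | ∀ n : ℕ, ¬ Forbidden p (histPrefix w n)}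

/-- The letters `w_{-1}` of admissible histories. -/
def admissibleLetters : Set G :=
  {x | ∃ w ∈ admissible p, w 0 = x}

/-- `a_k(g | w_{-1}, …, w_{-k})`. -/
def aLetter (k : ℕ) (g : G) (w : ℕ → G) : ℝ :=
  sInf (p.prob g '' {z | z ∈ admissible p ∧ histPrefix z k = histPrefix w k})

/-- `a_k(w_{-1}, …, w_{-k}) = ∑_g a_k(g | w_{-1}, …, w_{-k})`. -/
def aWord (k : ℕ) (w : ℕ → G) : ℝ :=
  ∑' g, aLetter p k g w

/-- `a_{k-1}(g | w)`, with `a_{-1} = 0`. -/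
def aLetterPrev : ℕ → G → (ℕ → G) → ℝ
  | 0, _, _ => 0
  | k + 1, g, w => aLetter p k g w

/-- `a_{k-1}(w)`, with `a_{-1} = 0`. -/
def aWordPrev : ℕ → (ℕ → G) → ℝ
  | 0, _ => 0
  | k + 1, w => aWord p k w

/-- The increments `b_k(g | w) = a_k(g | w) - a_{k-1}(g | w)`. -/
def bLetter (k : ℕ) (g : G) (w : ℕ → G) : ℝ :=
  aLetter p k g w - aLetterPrev p k g w

/-- `a_k`, the infimum of `a_k(w)` over the admissible histories. -/
def aInf (k : ℕ) : ℝ :=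
  sInf (aWord p k '' admissible p)

/-- The function `f(u | w)` is a maximal coupling function for `p`: for every `k` and every
admissible `w`, the interval `[a_{k-1}(w), a_k(w))` is partitioned into subintervals
`B_k(g | w_{-1}, …, w_{-k}) = [left, left + b_k(g | w))`, `g ∈ G`, and `f(· | w)` takes the
value `g` on each `B_k(g | w_{-1}, …, w_{-k})`. Only `u ∈ [0,1)` and admissible `w` matter. -/
def IsMaximalCoupling (f : ℝ → (ℕ → G) → G) : Prop :=
  ∃ left : ℕ → G → List G → ℝ, ∀ w ∈ admissible p, ∀ k : ℕ,
    (Pairwise fun g g' : G => Disjoint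
      (Set.Ico (left k g (histPrefix w k)) (left k g (histPrefix w k) + bLetter p k g w))
      (Set.Ico (left k g' (histPrefix w k)) (left k g' (histPrefix w k) + bLetter p k g' w))) ∧
    (⋃ g : G, Set.Ico (left k g (histPrefix w k))
      (left k g (histPrefix w k) + bLetter p k g w)) =
        Set.Ico (aWordPrev p k w) (aWord p k w) ∧
    ∀ g : G, ∀ u ∈ Set.Ico (left k g (histPrefix w k))
      (left k g (histPrefix w k) + bLetter p k g w), f u w = g

/-- `K(u) = inf {k : a_k > u}`, infinite if there is no such `k`. -/
def infoDepth (u : ℝ) : ℕ∞ :=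
  sInf {x : ℕ∞ | ∃ k : ℕ, u < aInf p k ∧ x = (k : ℕ∞)}

end Kernel

/-- The history obtained from `w` after `n` steps of `f`, driven by `u 0`, …, `u (n-1)` in this
temporal order. -/
def evolve {G : Type*} (f : ℝ → (ℕ → G) → G) (u : ℕ → ℝ) (w : ℕ → G) : ℕ → (ℕ → G)
  | 0 => w
  | n + 1 => histCons (f (u n) (evolve f u w n)) (evolve f u w n)

/-- `f^{(n+1)}(u_n, …, u_0 | w)`. -/
def iterSucc {G : Type*} (f : ℝ → (ℕ → G) → G) (n : ℕ) (u : ℕ → ℝ) (w : ℕ → G) : G :=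
  f (u n) (evolve f u w n)

section Markov

variable {G : Type*} [MeasurableSpace G] (p : HistoryKernel G) (f : ℝ → (ℕ → G) → G)

open Classical in
/-- The function `f̃(u | x) = f(a_1 u | w)` of the Markovian regime, for any choice of an
admissible history `w` with `w_{-1} = x` (irrelevant value if there is none). -/
def fMarkov (u : ℝ) (x : G) : G :=
  if h : ∃ w ∈ admissible p, w 0 = x then f (aInf p 1 * u) h.choose else x

/-- `f̃^{(n)}(u_{n-1}, …, u_0 | x)`: the composition of `n` steps of `f̃`, driven by
`u 0`, …, `u (n-1)` in this temporal order. -/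
def fMarkovIter : ℕ → (ℕ → ℝ) → G → G
  | 0, _, x => x
  | n + 1, u, x => fMarkov p f (u n) (fMarkovIter n u x)

/-- Coalescence `E_n` of the Markovian regime in `n` steps. Only the entries `u 0`, …, `u (n-1)`
(oldest first) matter; they have to lie in `[0,1)`. -/
def coalescence (n : ℕ) : Set (ℕ → ℝ) :=
  {u | (∀ i < n, u i ∈ Set.Ico (0 : ℝ) 1) ∧
    ∀ x ∈ admissibleLetters p, ∀ y ∈ admissibleLetters p,
      fMarkovIter p f n u x = fMarkovIter p f n u y}

/-- The times `m < 0` such that, for some `l ∈ [m, 0]`, the Markovian regime holds and coalesces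
on `[m, l]`, and `K(u_j) ≤ j - l` for `l < j ≤ 0`. -/
def goodTimes (u : ℤ → ℝ) : Set ℤ :=
  {m | m < 0 ∧ ∃ l : ℤ, m ≤ l ∧ l ≤ 0 ∧
    (fun k : ℕ => (aInf p 1)⁻¹ * u (m + k)) ∈ coalescence p f (l - m + 1).toNat ∧
    ∀ j : ℤ, l + 1 ≤ j → j ≤ 0 → infoDepth p (u j) ≤ ((j - l).toNat : ℕ∞)}

/-- `τ_0`, the supremum of the good times, equal to `⊥` (that is, `-∞`) if there is none. -/
def tauZero (u : ℤ → ℝ) : WithBot ℤ :=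
  sSup ((fun m : ℤ => (m : WithBot ℤ)) '' goodTimes p f u)

/-- `τ` is a backward coalescence time for `f` driven by `U`, with reference history `g`.
`F l` is the σ-algebra generated by `U_{-l}, …, U_0`. -/
structure IsBackwardCoalescenceTime {Ω : Type*} [MeasurableSpace Ω] (μ : Measure Ω)
    (U : ℤ → Ω → ℝ) (g : ℕ → G) (τ : Ω → WithBot ℤ) : Prop where
  nonpos : ∀ ω, τ ω ≤ 0
  finite_ae : ∀ᵐ ω ∂μ, τ ω ≠ ⊥
  stopping : ∀ l : ℕ,
    MeasurableSet[⨆ i ∈ Set.Icc (-(l : ℤ)) 0, MeasurableSpace.comap (U i) inferInstance]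
      {ω | τ ω = ((-(l : ℤ) : ℤ) : WithBot ℤ)}
  coalesce : ∀ (l : ℕ) (ω : Ω), τ ω = ((-(l : ℤ) : ℤ) : WithBot ℤ) →
    ∀ w ∈ admissible p,
      iterSucc f l (fun k : ℕ => U (-(l : ℤ) + k) ω) w =
        iterSucc f l (fun k : ℕ => U (-(l : ℤ) + k) ω) g

end Markov

end

end InfiniteMemory

/-!
Let `V i = U (-i)`. The idea is to look, going back in time, at the times `-n` for which
`V i < a_{n - i}` for all `i < n`: from such a time on, no step of `f` looks at letters older than
the letter at time `-n`. By independence `-n` has this property with probability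
`a_1 ⋯ a_n`, and the property is regenerative: if `n < n'`, then the condition at `n'`
restricts to the same condition for the sequence `V` with its first terms removed. Hence
`∑ a_1 ⋯ a_n = ∞` is recurrence of a renewal process.

At each renewal there is an independent chance that the Markovian regime has just coalesced, that
is, that the `s` variables `V n, …, V (n + s - 1)`, divided by `a_1`, belong to `E_s`. This chance is
positive by assumption, because the division by `a_1 ≤ 1` only rescales Lebesgue measure
(`pi_scaledCoalescence_ne_zero`). That such a marked renewal exists almost surely is
`ae_exists_isMarkedRenewal`. It is proved by decomposing over the last marked renewal rather than the
first: if `q` is the probability that there is none and `c` the probability of the mark, then the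
events "`n` is a marked renewal and the sequence beyond its mark has none" have probabilities
`q c a_1 ⋯ a_n`, and at most `s + 1` of them can occur together, so that `q c ∑ a_1 ⋯ a_n ≤ s + 1`.
A marked renewal is a witness for a good time, so `τ_0` is finite (`ae_tauZero_ne_bot`).

Coalescence at `τ_0` is deterministic (`iterSucc_eq_of_mem_goodTimes`). For `u < a_k` the value
`f(u | w)` depends on `k` letters of `w` only, and it leads to an admissible history again. So in the
Markovian regime the last letter evolves by `f̃` (`evolve_markov`) and becomes independent of the
initial history, and afterwards every step only uses letters that already are
(`evolve_agree`). The stopping property holds because `m` being a good time is an event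
about `U_m, …, U_0`, the coalescence events being measurable since `f` takes each value on a
countable union of intervals.
-/

namespace InfiniteMemory

/-! ### Histories and prefixes -/

lemma histPrefix_eq_iff {G : Type*} {w z : ℕ → G} {n : ℕ} :
    histPrefix w n = histPrefix z n ↔ ∀ i < n, w i = z i := by
  simp only [histPrefix, List.ofFn_inj, funext_iff]
  exact ⟨fun h i hi => h ⟨i, hi⟩, fun h i => h i i.2⟩

lemma histPrefix_histCons {G : Type*} (g : G) (w : ℕ → G) (n : ℕ) :
    histPrefix (histCons g w) (n + 1) = g :: histPrefix w n := by
  simp [histPrefix, List.ofFn_succ, histCons]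

lemma histPrefix_length {G : Type*} (w : ℕ → G) (n : ℕ) : (histPrefix w n).length = n := by
  simp [histPrefix]

section Kernel

variable {G : Type*} [MeasurableSpace G] {p : HistoryKernel G}

lemma histCons_mem_admissible {w : ℕ → G} (hw : w ∈ admissible p) {g : G}
    (hg : 0 < p.prob g w) : histCons g w ∈ admissible p := by
  rintro (_ | n)
  · simp [histPrefix, Forbidden]
  · rw [histPrefix_histCons]
    rintro (h | h)
    · exact hw n h
    · exact hg.ne' (h w (by rw [histPrefix_length]))

/-! ### The quantities `a_k` -/

lemma aLetter_bddBelow (k : ℕ) (g : G) (w : ℕ → G) :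
    BddBelow (p.prob g '' {z | z ∈ admissible p ∧ histPrefix z k = histPrefix w k}) :=
  ⟨0, by rintro _ ⟨z, -, rfl⟩; exact p.nonneg g z⟩

lemma aLetter_nonneg (k : ℕ) (g : G) (w : ℕ → G) : 0 ≤ aLetter p k g w :=
  Real.sInf_nonneg (by rintro _ ⟨z, -, rfl⟩; exact p.nonneg g z)

lemma aLetter_le_prob {w : ℕ → G} (hw : w ∈ admissible p) (k : ℕ) (g : G) :
    aLetter p k g w ≤ p.prob g w :=
  csInf_le (aLetter_bddBelow k g w) ⟨w, ⟨hw, rfl⟩, rfl⟩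

lemma aLetter_congr {w z : ℕ → G} {k : ℕ} (h : histPrefix w k = histPrefix z k) (g : G) :
    aLetter p k g w = aLetter p k g z := by
  simp only [aLetter, h]

lemma aLetter_summable {w : ℕ → G} (hw : w ∈ admissible p) (k : ℕ) :
    Summable fun g => aLetter p k g w :=
  (p.hasSum_one w).summable.of_nonneg_of_le (fun g => aLetter_nonneg k g w)
    fun g => aLetter_le_prob hw k g

lemma aWord_nonneg (k : ℕ) (w : ℕ → G) : 0 ≤ aWord p k w :=
  tsum_nonneg fun g => aLetter_nonneg k g w

lemma aWord_le_one {w : ℕ → G} (hw : w ∈ admissible p) (k : ℕ) : aWord p k w ≤ 1 :=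
  ((aLetter_summable hw k).tsum_le_tsum (fun g => aLetter_le_prob hw k g)
    (p.hasSum_one w).summable).trans_eq (p.hasSum_one w).tsum_eq

lemma aInf_nonneg (k : ℕ) : 0 ≤ aInf p k :=
  Real.sInf_nonneg (by rintro _ ⟨z, -, rfl⟩; exact aWord_nonneg k z)

lemma aInf_le_aWord {w : ℕ → G} (hw : w ∈ admissible p) (k : ℕ) : aInf p k ≤ aWord p k w :=
  csInf_le ⟨0, by rintro _ ⟨z, -, rfl⟩; exact aWord_nonneg k z⟩ ⟨w, hw, rfl⟩

lemma aInf_le_one {w : ℕ → G} (hw : w ∈ admissible p) (k : ℕ) : aInf p k ≤ 1 :=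
  (aInf_le_aWord hw k).trans (aWord_le_one hw k)

lemma bLetter_congr {w z : ℕ → G} {k : ℕ} (h : histPrefix w k = histPrefix z k) (g : G) :
    bLetter p k g w = bLetter p k g z := by
  cases k with
  | zero => simp only [bLetter, aLetterPrev, aLetter_congr h]
  | succ k =>
    have h' : histPrefix w k = histPrefix z k :=
      histPrefix_eq_iff.2 fun i hi => histPrefix_eq_iff.1 h i (by omega)
    simp only [bLetter, aLetterPrev, aLetter_congr h, aLetter_congr h']

lemma bLetter_le_prob {w : ℕ → G} (hw : w ∈ admissible p) (k : ℕ) (g : G) :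
    bLetter p k g w ≤ p.prob g w := by
  refine le_trans ?_ (aLetter_le_prob hw k g)
  cases k with
  | zero => simp [bLetter, aLetterPrev]
  | succ k => simpa [bLetter, aLetterPrev] using aLetter_nonneg k g w

lemma infoDepth_le_iff {u : ℝ} {n : ℕ} :
    infoDepth p u ≤ n ↔ ∃ k ≤ n, u < aInf p k := by
  constructor
  · intro h
    have hlt : infoDepth p u < ((n + 1 : ℕ) : ℕ∞) :=
      h.trans_lt (by exact_mod_cast Nat.lt_succ_self n)
    obtain ⟨x, ⟨k, hk, rfl⟩, hx⟩ := sInf_lt_iff.1 hlt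
    exact ⟨k, Nat.lt_succ_iff.1 (by exact_mod_cast hx), hk⟩
  · rintro ⟨k, hkn, hk⟩
    have hle : infoDepth p u ≤ (k : ℕ∞) := sInf_le ⟨k, hk, rfl⟩
    exact hle.trans (by exact_mod_cast hkn)

/-! ### The coupling function below level `a_k` -/

variable {f : ℝ → (ℕ → G) → G}

/-- Every `u ∈ [0, a_k)` lies in one of the cells `B_i(g | w)` with `i ≤ k`. -/
lemma exists_mem_cell {left : ℕ → G → List G → ℝ}
    (hl : ∀ w ∈ admissible p, ∀ k : ℕ,
      (⋃ g : G, Set.Ico (left k g (histPrefix w k))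
        (left k g (histPrefix w k) + bLetter p k g w)) =
          Set.Ico (aWordPrev p k w) (aWord p k w))
    {w : ℕ → G} (hw : w ∈ admissible p) {k : ℕ} {u : ℝ} (hu0 : 0 ≤ u) (hu : u < aInf p k) :
    ∃ i ≤ k, ∃ g, u ∈ Set.Ico (left i g (histPrefix w i))
      (left i g (histPrefix w i) + bLetter p i g w) := by
  classical
  have hex : ∃ i, u < aWord p i w := ⟨k, hu.trans_le (aInf_le_aWord hw k)⟩
  refine ⟨Nat.find hex, Nat.find_min' hex (hu.trans_le (aInf_le_aWord hw k)), ?_⟩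
  have hmem : u ∈ Set.Ico (aWordPrev p (Nat.find hex) w) (aWord p (Nat.find hex) w) := by
    refine ⟨?_, Nat.find_spec hex⟩
    rcases hi : Nat.find hex with _ | i
    · exact hu0
    · exact not_lt.1 (Nat.find_min hex (m := i) (by omega))
  rw [← hl w hw] at hmem
  simpa only [Set.mem_iUnion] using hmem

/-- For `u < a_k` the letter `f(u | w)` is a function of `w_{-1}, …, w_{-k}`. -/
lemma IsMaximalCoupling.congr (hf : IsMaximalCoupling p f) {w z : ℕ → G}
    (hw : w ∈ admissible p) (hz : z ∈ admissible p) {k : ℕ} (h : ∀ i < k, w i = z i)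
    {u : ℝ} (hu0 : 0 ≤ u) (hu : u < aInf p k) : f u w = f u z := by
  obtain ⟨left, hl⟩ := hf
  obtain ⟨i, hik, g, hg⟩ := exists_mem_cell (fun w hw k => (hl w hw k).2.1) hw hu0 hu
  have hp : histPrefix w i = histPrefix z i :=
    histPrefix_eq_iff.2 fun j hj => h j (hj.trans_le hik)
  rw [(hl w hw i).2.2 g u hg]
  rw [hp, bLetter_congr hp] at hg
  exact ((hl z hz i).2.2 g u hg).symm

/-- A step of `f` driven by some `u < a_k` leads from admissible histories to admissible ones:
the letter chosen has a nonempty cell, hence a positive probability. -/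
lemma IsMaximalCoupling.histCons_mem (hf : IsMaximalCoupling p f) {w : ℕ → G}
    (hw : w ∈ admissible p) {k : ℕ} {u : ℝ} (hu0 : 0 ≤ u) (hu : u < aInf p k) :
    histCons (f u w) w ∈ admissible p := by
  obtain ⟨left, hl⟩ := hf
  obtain ⟨i, -, g, hg⟩ := exists_mem_cell (fun w hw k => (hl w hw k).2.1) hw hu0 hu
  rw [(hl w hw i).2.2 g u hg]
  refine histCons_mem_admissible hw (lt_of_lt_of_le ?_ (bLetter_le_prob hw i g))
  linarith [hg.1, hg.2]

lemma IsMaximalCoupling.fMarkov_eq (hf : IsMaximalCoupling p f) (ha : 0 < aInf p 1)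
    {w : ℕ → G} (hw : w ∈ admissible p) {u : ℝ} (hu : u ∈ Set.Ico (0 : ℝ) 1) :
    fMarkov p f u (w 0) = f (aInf p 1 * u) w := by
  have h : ∃ z ∈ admissible p, z 0 = w 0 := ⟨w, hw, rfl⟩
  rw [fMarkov, dif_pos h]
  refine hf.congr h.choose_spec.1 hw (k := 1) (fun i hi => ?_)
    (mul_nonneg ha.le hu.1) (mul_lt_of_lt_one_right ha hu.2)
  obtain rfl : i = 0 := by omega
  exact h.choose_spec.2

/-! ### Coalescence of the iterates -/

/-- While the Markovian regime lasts, the most recent letter of the history evolves by `f̃`. -/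
lemma evolve_markov (hf : IsMaximalCoupling p f) (ha : 0 < aInf p 1) {w : ℕ → G}
    (hw : w ∈ admissible p) {v : ℕ → ℝ} {n : ℕ}
    (hv : ∀ i < n, (aInf p 1)⁻¹ * v i ∈ Set.Ico (0 : ℝ) 1) :
    evolve f v w n ∈ admissible p ∧
      evolve f v w n 0 = fMarkovIter p f n (fun k => (aInf p 1)⁻¹ * v k) (w 0) := by
  induction n with
  | zero => exact ⟨hw, rfl⟩
  | succ n ih =>
    obtain ⟨h1, h2⟩ := ih fun i hi => hv i (by omega)
    have hn := hv n (by omega)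
    have hmul : aInf p 1 * ((aInf p 1)⁻¹ * v n) = v n := mul_inv_cancel_left₀ ha.ne' _
    refine ⟨?_, ?_⟩
    · refine hf.histCons_mem h1 (k := 1) ?_ ?_
      · exact hmul ▸ mul_nonneg ha.le hn.1
      · exact hmul ▸ mul_lt_of_lt_one_right ha hn.2
    · rw [fMarkovIter, ← h2, hf.fMarkov_eq ha h1 hn, hmul]
      rfl

/-- Two histories with the same most recent letter at time `t₀` agree on all letters produced
since then, as long as no step looks further back than time `t₀`. -/
lemma evolve_agree (hf : IsMaximalCoupling p f) {w z : ℕ → G} {v : ℕ → ℝ} (hv0 : ∀ t, 0 ≤ v t)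
    {t₀ : ℕ} (hw : evolve f v w t₀ ∈ admissible p) (hz : evolve f v z t₀ ∈ admissible p)
    (h0 : evolve f v w t₀ 0 = evolve f v z t₀ 0) {n : ℕ}
    (hv : ∀ i < n, ∃ k ≤ i + 1, v (t₀ + i) < aInf p k) :
    evolve f v w (t₀ + n) ∈ admissible p ∧ evolve f v z (t₀ + n) ∈ admissible p ∧
      ∀ i ≤ n, evolve f v w (t₀ + n) i = evolve f v z (t₀ + n) i := by
  induction n with
  | zero =>
    refine ⟨hw, hz, fun i hi => ?_⟩
    obtain rfl : i = 0 := by omega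
    exact h0
  | succ n ih =>
    obtain ⟨h1, h2, h3⟩ := ih fun i hi => hv i (by omega)
    obtain ⟨k, hk, hlt⟩ := hv n (by omega)
    refine ⟨hf.histCons_mem h1 (hv0 _) hlt, hf.histCons_mem h2 (hv0 _) hlt, ?_⟩
    rintro (_ | i) hi
    · exact hf.congr h1 h2 (fun i hi => h3 i (by omega)) (hv0 _) hlt
    · exact h3 i (by omega)

lemma iterSucc_eq_of_mem_goodTimes (hf : IsMaximalCoupling p f) (ha : 0 < aInf p 1)
    {u : ℤ → ℝ} (hu : ∀ i, 0 ≤ u i) {l : ℕ} (hl : -(l : ℤ) ∈ goodTimes p f u)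
    {w z : ℕ → G} (hw : w ∈ admissible p) (hz : z ∈ admissible p) :
    iterSucc f l (fun k : ℕ => u (-(l : ℤ) + k)) w =
      iterSucc f l (fun k : ℕ => u (-(l : ℤ) + k)) z := by
  obtain ⟨-, r, hr1, hr2, ⟨hE, hco⟩, hK⟩ := hl
  obtain ⟨t, ht⟩ : ∃ t : ℕ, r = -(l : ℤ) + t := ⟨(r + l).toNat, by omega⟩
  have ht' : (r - -(l : ℤ) + 1).toNat = t + 1 := by omega
  rw [ht'] at hE hco
  set v : ℕ → ℝ := fun k : ℕ => u (-(l : ℤ) + k) with hv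
  obtain ⟨hw1, hw2⟩ := evolve_markov hf ha hw hE
  obtain ⟨hz1, hz2⟩ := evolve_markov hf ha hz hE
  have h0 : evolve f v w (t + 1) 0 = evolve f v z (t + 1) 0 := by
    rw [hw2, hz2]
    exact hco _ ⟨w, hw, rfl⟩ _ ⟨z, hz, rfl⟩
  obtain ⟨-, -, h⟩ := evolve_agree (n := l - t) hf (fun _ => hu _) hw1 hz1 h0 (by
    intro i hi
    have := hK (-(l : ℤ) + ((t + 1 + i : ℕ) : ℤ)) (by push_cast; omega) (by push_cast; omega)
    have he : (-(l : ℤ) + ((t + 1 + i : ℕ) : ℤ) - r).toNat = i + 1 := by push_cast; omega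
    rw [he, infoDepth_le_iff] at this
    exact this)
  have := h 0 (Nat.zero_le _)
  rw [show t + 1 + (l - t) = l + 1 by omega] at this
  exact this

/-! ### The supremum `τ_0` -/

lemma tauZero_eq_coe_iff {u : ℤ → ℝ} {m : ℤ} :
    tauZero p f u = (m : WithBot ℤ) ↔ IsGreatest (goodTimes p f u) m := by
  rcases (goodTimes p f u).eq_empty_or_nonempty with h | h
  · simp [tauZero, h, IsGreatest]
  · have hb : BddAbove (goodTimes p f u) := ⟨0, fun m hm => hm.1.le⟩
    have hmax : IsGreatest (goodTimes p f u) (sSup (goodTimes p f u)) :=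
      ⟨Int.csSup_mem h hb, fun m hm => le_csSup hb hm⟩
    have : tauZero p f u = ((sSup (goodTimes p f u) : ℤ) : WithBot ℤ) :=
      (WithBot.coe_sSup' h hb).symm
    rw [this, WithBot.coe_inj]
    exact ⟨fun e => e ▸ hmax, fun hm => hmax.unique hm⟩

lemma exists_tauZero_eq {u : ℤ → ℝ} {m : ℤ} (hm : m ∈ goodTimes p f u) :
    ∃ m' ∈ goodTimes p f u, tauZero p f u = (m' : WithBot ℤ) := by
  have hb : BddAbove (goodTimes p f u) := ⟨0, fun m hm => hm.1.le⟩
  have hmem := Int.csSup_mem ⟨m, hm⟩ hb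
  exact ⟨_, hmem, tauZero_eq_coe_iff.2 ⟨hmem, fun m hm => le_csSup hb hm⟩⟩

lemma tauZero_nonpos (u : ℤ → ℝ) : tauZero p f u ≤ 0 := by
  rcases (goodTimes p f u).eq_empty_or_nonempty with h | ⟨m, hm⟩
  · simp [tauZero, h]
  · obtain ⟨m', hm', he⟩ := exists_tauZero_eq hm
    rw [he]
    exact_mod_cast hm'.1.le

end Kernel

/-! ### A recurrent renewal process with independent marks -/

section Renewal

variable {X : Type*}

/-- `n` is a marked renewal of the sequence `v` if `v i ∈ A (n - i)` for all `i < n`, and the block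
`(v n, …, v (n + s - 1))`, its mark, belongs to `E`. -/
def IsMarkedRenewal (A : ℕ → Set X) {s : ℕ} (E : Set (Fin s → X)) (v : ℕ → X) (n : ℕ) : Prop :=
  (∀ i < n, v i ∈ A (n - i)) ∧ (fun i : Fin s => v (n + i)) ∈ E

/-- Regeneration: a marked renewal at `k + n` is one at `n` for the sequence with its first `k` terms
removed. -/
lemma IsMarkedRenewal.shift {A : ℕ → Set X} {s : ℕ} {E : Set (Fin s → X)} {v : ℕ → X} {n k : ℕ}
    (h : IsMarkedRenewal A E v (k + n)) : IsMarkedRenewal A E (fun i => v (k + i)) n := by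
  refine ⟨fun i hi => ?_, ?_⟩
  · have := h.1 (k + i) (by omega)
    rwa [Nat.add_sub_add_left] at this
  · simpa only [add_assoc] using h.2

variable [MeasurableSpace X] {A : ℕ → Set X} {s : ℕ} {E : Set (Fin s → X)}

lemma measurable_coord (S : Set ℕ) {i : ℕ} (hi : i ∈ S) :
    Measurable[⨆ j ∈ S, MeasurableSpace.comap (fun v : ℕ → X => v j) inferInstance]
      (fun v : ℕ → X => v i) := by
  rw [measurable_iff_comap_le]
  exact le_iSup₂ (f := fun j (_ : j ∈ S) =>
    MeasurableSpace.comap (fun v : ℕ → X => v j) inferInstance) i hi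

lemma measurableSet_forall_lt (hA : ∀ n, MeasurableSet (A n)) (n : ℕ) :
    MeasurableSet[⨆ j ∈ Set.Iio n, MeasurableSpace.comap (fun v : ℕ → X => v j) inferInstance]
      {v : ℕ → X | ∀ i < n, v i ∈ A (n - i)} := by
  have : {v : ℕ → X | ∀ i < n, v i ∈ A (n - i)} =
      ⋂ i, ⋂ _ : i < n, (fun v : ℕ → X => v i) ⁻¹' A (n - i) := by
    ext v; simp
  rw [this]
  exact MeasurableSet.iInter fun i => MeasurableSet.iInter fun hi =>
    measurable_coord (Set.Iio n) (i := i) hi (hA _)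

lemma measurableSet_mark (hE : MeasurableSet E) (n : ℕ) :
    MeasurableSet[⨆ j ∈ Set.Ico n (n + s),
      MeasurableSpace.comap (fun v : ℕ → X => v j) inferInstance]
      {v : ℕ → X | (fun i : Fin s => v (n + i)) ∈ E} := by
  have : Measurable[⨆ j ∈ Set.Ico n (n + s),
      MeasurableSpace.comap (fun v : ℕ → X => v j) inferInstance]
      (fun v : ℕ → X => fun i : Fin s => v (n + i)) :=
    (@measurable_pi_iff _ _ _ (_) _ _).2 fun i =>
      measurable_coord _ (i := n + i) ⟨by omega, by omega⟩
  exact this hE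

lemma measurableSet_isMarkedRenewal (hA : ∀ n, MeasurableSet (A n)) (hE : MeasurableSet E)
    (n : ℕ) : MeasurableSet {v | IsMarkedRenewal A E v n} := by
  have hle : ∀ S : Set ℕ, (⨆ j ∈ S, MeasurableSpace.comap (fun v : ℕ → X => v j) inferInstance) ≤
      (inferInstance : MeasurableSpace (ℕ → X)) :=
    fun S => iSup₂_le fun j _ => (measurable_pi_apply j).comap_le
  exact (hle _ _ (measurableSet_forall_lt hA n)).inter (hle _ _ (measurableSet_mark hE n))

lemma measurableSet_shift_preimage {B : Set (ℕ → X)} (hB : MeasurableSet B) (k : ℕ) :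
    MeasurableSet[⨆ j ∈ Set.Ici k, MeasurableSpace.comap (fun v : ℕ → X => v j) inferInstance]
      {v : ℕ → X | (fun i => v (k + i)) ∈ B} := by
  have : Measurable[⨆ j ∈ Set.Ici k,
      MeasurableSpace.comap (fun v : ℕ → X => v j) inferInstance]
      (fun v : ℕ → X => fun i : ℕ => v (k + i)) :=
    (@measurable_pi_iff _ _ _ (_) _ _).2 fun i =>
      measurable_coord _ (i := k + i) (by simp)
  exact this hB

variable (ν : Measure X) [IsProbabilityMeasure ν]

lemma infinitePi_forall_lt (hA : ∀ n, MeasurableSet (A n)) (n : ℕ) :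
    Measure.infinitePi (fun _ : ℕ => ν) {v | ∀ i < n, v i ∈ A (n - i)} =
      ∏ m ∈ Finset.Icc 1 n, ν (A m) := by
  have : {v : ℕ → X | ∀ i < n, v i ∈ A (n - i)} =
      Set.pi (Finset.range n : Set ℕ) fun i => A (n - i) := by
    ext v; simp
  rw [this, Measure.infinitePi_pi _ fun i _ => hA _]
  refine Finset.prod_nbij' (fun i => n - i) (fun i => n - i) ?_ ?_ ?_ ?_ ?_ <;> intro i hi <;>
    simp only [Finset.mem_range, Finset.mem_Icc] at * <;> omega

/-- The renewal condition at `n`, the mark at `n` and an event about the sequence beyond the mark are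
independent, being about disjoint sets of coordinates, and the probabilities of the last two do not
depend on `n`. -/
lemma infinitePi_isMarkedRenewal_inter (hA : ∀ n, MeasurableSet (A n)) (hE : MeasurableSet E)
    {B : Set (ℕ → X)} (hB : MeasurableSet B) (n : ℕ) :
    Measure.infinitePi (fun _ : ℕ => ν)
      ({v | IsMarkedRenewal A E v n} ∩ {v | (fun i => v (n + s + i)) ∈ B}) =
      (∏ m ∈ Finset.Icc 1 n, ν (A m)) *
        (Measure.pi (fun _ : Fin s => ν) E * Measure.infinitePi (fun _ : ℕ => ν) B) := by
  have hind : iIndep (fun j => MeasurableSpace.comap (fun v : ℕ → X => v j) inferInstance)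
      (Measure.infinitePi fun _ : ℕ => ν) :=
    iIndepFun_infinitePi (P := fun _ : ℕ => ν) (X := fun _ x => x) fun _ => measurable_id
  have hle : ∀ j : ℕ, MeasurableSpace.comap (fun v : ℕ → X => v j) inferInstance ≤
      (inferInstance : MeasurableSpace (ℕ → X)) := fun j => (measurable_pi_apply j).comap_le
  have hmono : ∀ {S T : Set ℕ}, S ⊆ T →
      (⨆ j ∈ S, MeasurableSpace.comap (fun v : ℕ → X => v j) inferInstance) ≤
      ⨆ j ∈ T, MeasurableSpace.comap (fun v : ℕ → X => v j) inferInstance :=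
    fun h => biSup_mono h
  have h1 : Disjoint (Set.Iio (n + s)) (Set.Ici (n + s)) :=
    Set.disjoint_left.2 fun i hi hi' => not_lt.2 (Set.mem_Ici.1 hi') hi
  have h2 : Disjoint (Set.Iio n) (Set.Ico n (n + s)) :=
    Set.disjoint_left.2 fun i hi hi' => not_lt.2 hi'.1 hi
  have hR := measurableSet_forall_lt hA n
  have hC := measurableSet_mark hE n
  have hRC : {v | IsMarkedRenewal A E v n} = {v : ℕ → X | ∀ i < n, v i ∈ A (n - i)} ∩
    {v | (fun i : Fin s => v (n + i)) ∈ E} := rfl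
  rw [(Indep_iff _ _ _).1 (indep_iSup_of_disjoint hle hind h1) _ _ ?_
    (measurableSet_shift_preimage hB (n + s)), hRC,
    (Indep_iff _ _ _).1 (indep_iSup_of_disjoint hle hind h2) _ _ hR hC,
    infinitePi_forall_lt ν hA, mul_assoc]
  · congr 2
    · have := Measure.map_infinitePi_infinitePi_of_inj (P := fun _ : ℕ => ν)
        (f := fun i : Fin s => n + (i : ℕ)) fun i j h => Fin.ext (by simpa using h)
      rw [← Measure.infinitePi_eq_pi, ← this, Measure.map_apply (by fun_prop) hE]
      rfl
    · have := Measure.map_infinitePi_infinitePi_of_inj (P := fun _ : ℕ => ν)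
        (f := fun i : ℕ => n + s + i) fun i j h => by simpa using h
      conv_rhs => rw [← this, Measure.map_apply (by fun_prop) hB]
      rfl
  · rw [hRC]
    exact MeasurableSet.inter (hmono (fun i hi => lt_of_lt_of_le hi (Nat.le_add_right n s)) _ hR)
      (hmono (fun i hi => hi.2) _ hC)

/-- Marked renewals exist almost surely if the renewal process is recurrent and marks have positive
probability. Let `q` be the probability that there is none. With probability
`q c ∏_{m ≤ n} ν (A m)`, where `c` is the probability of the mark, `n` is a marked renewal and the
sequence beyond its mark has none; such indices `n` differ by at most `s`, so these probabilities
sum up to at most `s + 1`, which forces `q = 0`. -/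
theorem ae_exists_isMarkedRenewal (hA : ∀ n, MeasurableSet (A n)) (hE : MeasurableSet E)
    (hE0 : Measure.pi (fun _ : Fin s => ν) E ≠ 0)
    (hsum : Tendsto (fun N : ℕ => ∑ n ∈ Finset.Icc 1 N, ∏ m ∈ Finset.Icc 1 n, ν (A m)) atTop
      (nhds ⊤)) :
    ∀ᵐ v ∂Measure.infinitePi (fun _ : ℕ => ν), ∃ n, 1 ≤ n ∧ IsMarkedRenewal A E v n := by
  classical
  set P := Measure.infinitePi (fun _ : ℕ => ν)
  set B : Set (ℕ → X) := {v | ¬ ∃ n, 1 ≤ n ∧ IsMarkedRenewal A E v n} with hBdef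
  have hB : MeasurableSet B := by
    have : B = (⋃ n, ⋃ _ : 1 ≤ n, {v | IsMarkedRenewal A E v n})ᶜ := by
      ext v; simp [hBdef]
    rw [this]
    exact (MeasurableSet.iUnion fun n => MeasurableSet.iUnion fun _ =>
      measurableSet_isMarkedRenewal hA hE n).compl
  change P B = 0
  by_contra hq
  set c := Measure.pi (fun _ : Fin s => ν) E
  let D : ℕ → Set (ℕ → X) := fun n =>
    {v | IsMarkedRenewal A E v n} ∩ {v | (fun i => v (n + s + i)) ∈ B}
  have hD : ∀ n, MeasurableSet (D n) := fun n =>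
    (measurableSet_isMarkedRenewal hA hE n).inter
      ((show Measurable fun (v : ℕ → X) (i : ℕ) => v (n + s + i) by fun_prop) hB)
  have hclose : ∀ v n n', v ∈ D n → v ∈ D n' → n' ≤ n + s := by
    intro v n n' hn hn'
    by_contra! hlt
    obtain ⟨k, rfl⟩ := Nat.exists_eq_add_of_lt hlt
    exact hn.2 ⟨k + 1, by omega, IsMarkedRenewal.shift (k := n + s) hn'.1⟩
  have hcount : ∀ (N : ℕ) (v : ℕ → X),
      ∑ n ∈ Finset.Icc 1 N, (D n).indicator (1 : (ℕ → X) → ENNReal) v ≤ (s + 1 : ℕ) := by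
    intro N v
    simp only [Set.indicator_apply, Pi.one_apply]
    rw [Finset.sum_boole]
    rcases ((Finset.Icc 1 N).filter fun n => v ∈ D n).eq_empty_or_nonempty with h | h
    · simp [h]
    · have hmin := Finset.min'_mem _ h
      set n₀ := Finset.min' _ h with hn₀
      have hsub : ((Finset.Icc 1 N).filter fun n => v ∈ D n) ⊆ Finset.Icc n₀ (n₀ + s) :=
        fun n hn => Finset.mem_Icc.2 ⟨Finset.min'_le _ _ hn,
          hclose v _ _ (Finset.mem_filter.1 hmin).2 (Finset.mem_filter.1 hn).2⟩
      have hcard := Finset.card_le_card hsub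
      rw [Nat.card_Icc] at hcard
      exact_mod_cast hcard.trans (by omega)
  have hbound : ∀ N : ℕ,
      (∑ n ∈ Finset.Icc 1 N, ∏ m ∈ Finset.Icc 1 n, ν (A m)) * (c * P B) ≤ (s + 1 : ℕ) := by
    intro N
    calc (∑ n ∈ Finset.Icc 1 N, ∏ m ∈ Finset.Icc 1 n, ν (A m)) * (c * P B)
        = ∑ n ∈ Finset.Icc 1 N, P (D n) := by
          rw [Finset.sum_mul]
          exact Finset.sum_congr rfl fun n _ =>
            (infinitePi_isMarkedRenewal_inter ν hA hE hB n).symm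
      _ = ∫⁻ v, ∑ n ∈ Finset.Icc 1 N, (D n).indicator (1 : (ℕ → X) → ENNReal) v ∂P := by
          rw [lintegral_finsetSum _ fun n _ => measurable_one.indicator (hD n)]
          exact Finset.sum_congr rfl fun n _ => (lintegral_indicator_one (hD n)).symm
      _ ≤ ∫⁻ _, ((s + 1 : ℕ) : ENNReal) ∂P := lintegral_mono (hcount N)
      _ = (s + 1 : ℕ) := by simp
  have hlim := ENNReal.Tendsto.mul_const (b := c * P B) hsum (Or.inl ENNReal.top_ne_zero)
  rw [ENNReal.top_mul (mul_ne_zero hE0 hq)] at hlim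
  exact ENNReal.natCast_ne_top _ (top_le_iff.1 (le_of_tendsto' hlim hbound))

end Renewal

/-! ### Measurability of the coalescence events -/

section Measurability

variable {G : Type*} [MeasurableSpace G] {p : HistoryKernel G} {f : ℝ → (ℕ → G) → G}

lemma fMarkovIter_congr {n : ℕ} {u v : ℕ → ℝ} (h : ∀ i < n, u i = v i) (x : G) :
    fMarkovIter p f n u x = fMarkovIter p f n v x := by
  induction n with
  | zero => rfl
  | succ n ih => rw [fMarkovIter, fMarkovIter, ih fun i hi => h i (by omega), h n (by omega)]

lemma coalescence_congr {n : ℕ} {u v : ℕ → ℝ} (h : ∀ i < n, u i = v i) :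
    u ∈ coalescence p f n ↔ v ∈ coalescence p f n := by
  refine and_congr (forall₂_congr fun i hi => by rw [h i hi]) ?_
  simp only [fMarkovIter_congr h]

/-- The coupling function is measurable on `[0, 1)` in the Markovian regime: there its level sets
are countable unions of intervals. -/
lemma measurableSet_fMarkov_eq (hf : IsMaximalCoupling p f) (ha : 0 < aInf p 1) (x y : G) :
    MeasurableSet {u : ℝ | u ∈ Set.Ico (0 : ℝ) 1 ∧ fMarkov p f u x = y} := by
  by_cases hx : ∃ w ∈ admissible p, w 0 = x
  · obtain ⟨w, hw, rfl⟩ := hx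
    obtain ⟨left, hl⟩ := id hf
    have : {u : ℝ | u ∈ Set.Ico (0 : ℝ) 1 ∧ fMarkov p f u (w 0) = y} =
        Set.Ico (0 : ℝ) 1 ∩ ⋃ i : ℕ, (fun u => aInf p 1 * u) ⁻¹'
          Set.Ico (left i y (histPrefix w i)) (left i y (histPrefix w i) + bLetter p i y w) := by
      ext u
      refine and_congr_right fun hu => ?_
      rw [hf.fMarkov_eq ha hw hu, Set.mem_iUnion]
      constructor
      · rintro rfl
        obtain ⟨i, -, g, hg⟩ := exists_mem_cell (fun w hw k => (hl w hw k).2.1) hw (k := 1)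
          (mul_nonneg ha.le hu.1) (mul_lt_of_lt_one_right ha hu.2)
        refine ⟨i, ?_⟩
        rw [(hl w hw i).2.2 g _ hg]
        exact hg
      · rintro ⟨i, hi⟩
        exact (hl w hw i).2.2 y _ hi
    rw [this]
    exact measurableSet_Ico.inter (MeasurableSet.iUnion fun i =>
      (measurable_const_mul _) measurableSet_Ico)
  · simp only [fMarkov, dif_neg hx]
    exact measurableSet_Ico.inter (MeasurableSet.const _)

variable [Countable G]

lemma measurableSet_fMarkovIter_eq (hf : IsMaximalCoupling p f) (ha : 0 < aInf p 1)
    {S : Type*} [MeasurableSpace S] {V : ℕ → S → ℝ} {n : ℕ} (hV : ∀ i < n, Measurable (V i))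
    (x y : G) :
    MeasurableSet {ω | (∀ i < n, V i ω ∈ Set.Ico (0 : ℝ) 1) ∧
      fMarkovIter p f n (fun k => V k ω) x = y} := by
  induction n generalizing y with
  | zero => simp [fMarkovIter]
  | succ n ih =>
    have : {ω | (∀ i < n + 1, V i ω ∈ Set.Ico (0 : ℝ) 1) ∧
        fMarkovIter p f (n + 1) (fun k => V k ω) x = y} =
        ⋃ z : G, {ω | (∀ i < n, V i ω ∈ Set.Ico (0 : ℝ) 1) ∧
          fMarkovIter p f n (fun k => V k ω) x = z} ∩
          V n ⁻¹' {u | u ∈ Set.Ico (0 : ℝ) 1 ∧ fMarkov p f u z = y} := by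
      ext ω
      simp only [Set.mem_ofPred_eq, Set.mem_iUnion, Set.mem_inter_iff, Set.mem_preimage,
        Nat.forall_lt_succ_right, fMarkovIter]
      constructor
      · rintro ⟨⟨h1, h2⟩, h3⟩
        exact ⟨_, ⟨h1, rfl⟩, h2, h3⟩
      · rintro ⟨z, ⟨h1, rfl⟩, h2, h3⟩
        exact ⟨⟨h1, h2⟩, h3⟩
    rw [this]
    exact MeasurableSet.iUnion fun z => (ih (fun i hi => hV i (by omega)) z).inter
      (hV n (by omega) (measurableSet_fMarkov_eq hf ha z y))

lemma measurableSet_coalescence (hf : IsMaximalCoupling p f) (ha : 0 < aInf p 1)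
    {S : Type*} [MeasurableSpace S] {V : ℕ → S → ℝ} {n : ℕ} (hV : ∀ i < n, Measurable (V i)) :
    MeasurableSet {ω | (fun k => V k ω) ∈ coalescence p f n} := by
  have hbox : MeasurableSet {ω | ∀ i < n, V i ω ∈ Set.Ico (0 : ℝ) 1} := by
    simp only [Set.ofPred_forall]
    exact MeasurableSet.iInter fun i => MeasurableSet.iInter fun hi => hV i hi measurableSet_Ico
  have : {ω | (fun k => V k ω) ∈ coalescence p f n} =
      {ω | ∀ i < n, V i ω ∈ Set.Ico (0 : ℝ) 1} ∩
      ⋂ x : G, ⋂ _ : x ∈ admissibleLetters p, ⋂ y : G, ⋂ _ : y ∈ admissibleLetters p, ⋃ z : G,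
        {ω | (∀ i < n, V i ω ∈ Set.Ico (0 : ℝ) 1) ∧
          fMarkovIter p f n (fun k => V k ω) x = z} ∩
        {ω | (∀ i < n, V i ω ∈ Set.Ico (0 : ℝ) 1) ∧
          fMarkovIter p f n (fun k => V k ω) y = z} := by
    ext ω
    refine and_congr_right fun hω => ?_
    simp only [Set.mem_iInter, Set.mem_iUnion, Set.mem_inter_iff, Set.mem_ofPred_eq]
    refine forall₄_congr fun x _ y _ => ⟨fun h => ⟨_, ⟨hω, rfl⟩, hω, h.symm⟩, ?_⟩
    rintro ⟨z, ⟨-, h1⟩, -, h2⟩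
    exact h1.trans h2.symm
  rw [this]
  exact hbox.inter <| MeasurableSet.iInter fun x => MeasurableSet.iInter fun _ =>
    MeasurableSet.iInter fun y => MeasurableSet.iInter fun _ => MeasurableSet.iUnion fun z =>
      (measurableSet_fMarkovIter_eq hf ha hV x z).inter
        (measurableSet_fMarkovIter_eq hf ha hV y z)

lemma measurableSet_mem_goodTimes (hf : IsMaximalCoupling p f) (ha : 0 < aInf p 1)
    {S : Type*} [MeasurableSpace S] {U : ℤ → S → ℝ} {m : ℤ}
    (hU : ∀ i, m ≤ i → i ≤ 0 → Measurable (U i)) :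
    MeasurableSet {ω | m ∈ goodTimes p f fun i => U i ω} := by
  have : {ω | m ∈ goodTimes p f fun i => U i ω} = {_ω | m < 0} ∩ ⋃ l : ℤ,
      {_ω | m ≤ l} ∩ ({_ω | l ≤ 0} ∩
        ({ω | (fun k : ℕ => (aInf p 1)⁻¹ * U (m + k) ω) ∈ coalescence p f (l - m + 1).toNat} ∩
          {ω | ∀ j : ℤ, l + 1 ≤ j → j ≤ 0 →
            infoDepth p (U j ω) ≤ ((j - l).toNat : ℕ∞)})) := by
    ext ω
    simp [goodTimes]
  rw [this]
  refine (MeasurableSet.const _).inter (MeasurableSet.iUnion fun l => ?_)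
  by_cases h1 : m ≤ l
  · by_cases h2 : l ≤ 0
    · refine (MeasurableSet.const _).inter ((MeasurableSet.const _).inter (.inter ?_ ?_))
      · exact measurableSet_coalescence hf ha (V := fun k ω => (aInf p 1)⁻¹ * U (m + k) ω)
          fun i hi => (hU _ (by omega) (by omega)).const_mul _
      · simp only [Set.ofPred_forall]
        refine MeasurableSet.iInter fun j => MeasurableSet.iInter fun hj =>
          MeasurableSet.iInter fun hj' => ?_
        have : {ω | infoDepth p (U j ω) ≤ ((j - l).toNat : ℕ∞)} =
            ⋃ k : ℕ, ⋃ _ : k ≤ (j - l).toNat, U j ⁻¹' Set.Iio (aInf p k) := by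
          ext ω
          simp [infoDepth_le_iff]
        rw [this]
        exact MeasurableSet.iUnion fun k => MeasurableSet.iUnion fun _ =>
          hU j (by omega) hj' measurableSet_Iio
    · simp [h2]
  · simp [h1]

end Measurability

/-! ### Almost sure finiteness of `τ_0` -/

section Finiteness

variable {Ω : Type*} [MeasurableSpace Ω] {μ : Measure Ω} {U : ℤ → Ω → ℝ}

/-- The law of an injectively reindexed i.i.d. family. -/
lemma map_reindex_eq_infinitePi (hU_meas : ∀ i, Measurable (U i)) (hU_indep : iIndepFun U μ)
    {ν : Measure ℝ} (hU : ∀ i, μ.map (U i) = ν) {ι : Type*} {e : ι → ℤ}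
    (he : Function.Injective e) :
    μ.map (fun ω i => U (e i) ω) = Measure.infinitePi fun _ : ι => ν := by
  rw [(hU_indep.precomp he).map_fun_eq_infinitePi_map fun i => hU_meas _]
  simp only [hU]

instance isProbabilityMeasure_uniform :
    IsProbabilityMeasure (volume.restrict (Set.Ico (0 : ℝ) 1)) :=
  ⟨by simp⟩

variable {G : Type*} [MeasurableSpace G] {p : HistoryKernel G}
  {f : ℝ → (ℕ → G) → G}

/-- Blocks, most recent entry first, that become coalescing when scaled by `c`. The index
`s - 1 - k` restores the temporal order. -/
def scaledCoalescence (p : HistoryKernel G) (f : ℝ → (ℕ → G) → G) {s : ℕ} (hs : 0 < s) (c : ℝ) :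
    Set (Fin s → ℝ) :=
  {x | (fun k : ℕ => c * x ⟨s - 1 - k, by omega⟩) ∈ coalescence p f s}

lemma measurableSet_scaledCoalescence [Countable G] (hf : IsMaximalCoupling p f)
    (ha : 0 < aInf p 1) {s : ℕ} (hs : 0 < s) (c : ℝ) : MeasurableSet (scaledCoalescence p f hs c) :=
  measurableSet_coalescence hf ha
    (V := fun k (x : Fin s → ℝ) => c * x ⟨s - 1 - k, by omega⟩) fun i _ => by fun_prop

lemma scaledCoalescence_subset {s : ℕ} (hs : 0 < s) {c : ℝ} (hc : 1 ≤ c) :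
    scaledCoalescence p f hs c ⊆ Set.univ.pi fun _ => Set.Ico (0 : ℝ) 1 := by
  intro x hx i _
  have h := hx.1 (s - 1 - i) (by omega)
  have hi : (⟨s - 1 - (s - 1 - i), by omega⟩ : Fin s) = i := Fin.ext (by simp only; omega)
  simp only [hi] at h
  have h0 : 0 ≤ x i := nonneg_of_mul_nonneg_right h.1 (by linarith)
  exact ⟨h0, by nlinarith [h.2]⟩

/-- Scaling down by `a ≤ 1` preserves positivity of the probability of coalescence, since the
coalescing blocks lie in the unit cube, where the law of the blocks is Lebesgue measure. -/
lemma pi_scaledCoalescence_ne_zero {s : ℕ} (hs : 0 < s) {a : ℝ} (ha : 0 < a) (ha1 : a ≤ 1)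
    (h : Measure.pi (fun _ : Fin s => volume.restrict (Set.Ico (0 : ℝ) 1))
      (scaledCoalescence p f hs 1) ≠ 0) :
    Measure.pi (fun _ : Fin s => volume.restrict (Set.Ico (0 : ℝ) 1))
      (scaledCoalescence p f hs a⁻¹) ≠ 0 := by
  have hbox : MeasurableSet (Set.univ.pi fun _ : Fin s => Set.Ico (0 : ℝ) 1) :=
    MeasurableSet.univ_pi fun _ => measurableSet_Ico
  rw [← Measure.restrict_pi_pi, Measure.restrict_apply' hbox,
    Set.inter_eq_left.2 (scaledCoalescence_subset hs ?_)] at h ⊢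
  · have hpre : scaledCoalescence p f hs a⁻¹ =
        (fun x : Fin s → ℝ => a⁻¹ • x) ⁻¹' scaledCoalescence p f hs 1 := by
      ext x
      simp [scaledCoalescence]
    rw [hpre, ← volume_pi, Measure.addHaar_preimage_smul _ (inv_ne_zero ha.ne')]
    refine mul_ne_zero ?_ h
    simp [ha.ne']
  · exact (one_le_inv₀ ha).2 ha1
  · exact le_rfl

theorem ae_tauZero_ne_bot [Countable G] [IsProbabilityMeasure μ]
    (hne : (admissible p).Nonempty) (hf : IsMaximalCoupling p f) (hU_meas : ∀ i, Measurable (U i))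
    (hU_unif : ∀ i, μ.map (U i) = volume.restrict (Set.Ico (0 : ℝ) 1))
    (hU_indep : iIndepFun U μ) (ha : 0 < aInf p 1)
    (hi : Tendsto (fun N : ℕ => ∑ n ∈ Finset.Icc 1 N, ∏ m ∈ Finset.Icc 1 n, aInf p m)
      atTop atTop)
    {s : ℕ} (hs : 0 < s) (hii : 0 < μ {ω | (fun k : ℕ => U (k : ℤ) ω) ∈ coalescence p f s}) :
    ∀ᵐ ω ∂μ, tauZero p f (fun i => U i ω) ≠ ⊥ := by
  obtain ⟨w, hw⟩ := hne
  set ν : Measure ℝ := volume.restrict (Set.Ico (0 : ℝ) 1) with hν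
  have hpos : Measure.pi (fun _ : Fin s => ν) (scaledCoalescence p f hs 1) ≠ 0 := by
    have hinj : Function.Injective fun i : Fin s => ((s - 1 - i : ℕ) : ℤ) := by
      intro i j hij
      have : s - 1 - (i : ℕ) = s - 1 - j := Int.natCast_inj.1 hij
      exact Fin.ext (by omega)
    rw [← Measure.infinitePi_eq_pi,
      ← map_reindex_eq_infinitePi hU_meas hU_indep hU_unif hinj,
      Measure.map_apply (measurable_pi_lambda _ fun i => hU_meas _)
        (measurableSet_scaledCoalescence hf ha hs 1)]
    refine (hii.trans_le (measure_mono fun ω hω => ?_)).ne'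
    refine (coalescence_congr fun i hi => ?_).1 hω
    have : s - 1 - (s - 1 - i) = i := by omega
    simp only [this, one_mul]
  have hsum : Tendsto (fun N : ℕ => ∑ n ∈ Finset.Icc 1 N, ∏ m ∈ Finset.Icc 1 n,
      ν (Set.Iio (aInf p m))) atTop (nhds ⊤) := by
    have hνa : ∀ m, ν (Set.Iio (aInf p m)) = ENNReal.ofReal (aInf p m) := by
      intro m
      have : Set.Iio (aInf p m) ∩ Set.Ico 0 1 = Set.Ico 0 (aInf p m) := by
        ext x
        have := aInf_le_one hw m
        simp only [Set.mem_inter_iff, Set.mem_Iio, Set.mem_Ico]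
        exact ⟨fun h => ⟨h.2.1, h.1⟩, fun h => ⟨h.2, h.1, h.2.trans_le this⟩⟩
      rw [hν, Measure.restrict_apply measurableSet_Iio, this, Real.volume_Ico, sub_zero]
    refine (ENNReal.tendsto_ofReal_atTop.comp hi).congr fun N => ?_
    rw [Function.comp_apply, ENNReal.ofReal_sum_of_nonneg fun n _ =>
      Finset.prod_nonneg fun m _ => aInf_nonneg m]
    refine Finset.sum_congr rfl fun n _ => ?_
    rw [ENNReal.ofReal_prod_of_nonneg fun m _ => aInf_nonneg m]
    exact Finset.prod_congr rfl fun m _ => (hνa m).symm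
  have hren := ae_exists_isMarkedRenewal ν (A := fun m => Set.Iio (aInf p m))
    (fun _ => measurableSet_Iio) (measurableSet_scaledCoalescence hf ha hs (aInf p 1)⁻¹)
    (pi_scaledCoalescence_ne_zero hs ha (aInf_le_one hw 1) hpos) hsum
  have hinj : Function.Injective fun i : ℕ => -(i : ℤ) := fun i j h => by simpa using h
  rw [← map_reindex_eq_infinitePi hU_meas hU_indep hU_unif hinj] at hren
  filter_upwards [ae_of_ae_map (measurable_pi_lambda _ fun i => hU_meas _).aemeasurable hren]
    with ω hω
  obtain ⟨n, hn, hdepth, hmark⟩ := hω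
  -- A marked renewal at `n` means that `l = -n` and `m = -n - s + 1` witness a good time.
  have hgood : -(n : ℤ) - s + 1 ∈ goodTimes p f fun i => U i ω := by
    refine ⟨by omega, -(n : ℤ), by omega, by omega, ?_, fun j hj1 hj2 => ?_⟩
    · have hlen : (-(n : ℤ) - (-(n : ℤ) - s + 1) + 1).toNat = s := by omega
      rw [hlen]
      refine (coalescence_congr fun k hk => ?_).1 hmark
      have hidx : -((n + (s - 1 - k) : ℕ) : ℤ) = -(n : ℤ) - s + 1 + k := by omega
      simp only [hidx]
    · rw [infoDepth_le_iff]
      refine ⟨(j - -(n : ℤ)).toNat, le_rfl, ?_⟩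
      have := hdepth (-j).toNat (by omega)
      have h1 : n - (-j).toNat = (j - -(n : ℤ)).toNat := by omega
      have h2 : -((-j).toNat : ℤ) = j := by omega
      simp only [h1, h2] at this
      exact this
  obtain ⟨m, -, hm⟩ := exists_tauZero_eq hgood
  rw [hm]
  exact WithBot.coe_ne_bot

end Finiteness

/-! ### `τ_0` as a stopping time -/

lemma measurableSet_tauZero_eq {G : Type*} [Countable G] [MeasurableSpace G]
    {p : HistoryKernel G} {f : ℝ → (ℕ → G) → G} (hf : IsMaximalCoupling p f) (ha : 0 < aInf p 1)
    {S : Type*} [MeasurableSpace S] {U : ℤ → S → ℝ} {m : ℤ}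
    (hU : ∀ i, m ≤ i → i ≤ 0 → Measurable (U i)) :
    MeasurableSet {ω | tauZero p f (fun i => U i ω) = (m : WithBot ℤ)} := by
  have : {ω | tauZero p f (fun i => U i ω) = (m : WithBot ℤ)} =
      {ω | m ∈ goodTimes p f fun i => U i ω} ∩
        ⋂ k : ℤ, ⋂ _ : m < k, {ω | k ∈ goodTimes p f fun i => U i ω}ᶜ := by
    ext ω
    simp only [Set.mem_ofPred_eq, tauZero_eq_coe_iff, IsGreatest, mem_upperBounds, Set.mem_inter_iff,
      Set.mem_iInter, Set.mem_compl_iff]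
    exact and_congr_right fun _ => forall_congr' fun k =>
      ⟨fun h hk hk' => not_lt.2 (h hk') hk, fun h hk => not_lt.1 fun hk' => h hk' hk⟩
  rw [this]
  exact (measurableSet_mem_goodTimes hf ha hU).inter <| MeasurableSet.iInter fun k =>
    MeasurableSet.iInter fun hk =>
      (measurableSet_mem_goodTimes hf ha fun i hi => hU i (hk.le.trans hi)).compl

end InfiniteMemory

theorem mainTheorem2 {G : Type*} [Countable G] [MeasurableSpace G] [DiscreteMeasurableSpace G]
    (p : InfiniteMemory.HistoryKernel G)
    (g : ℕ → G) (hg : g ∈ InfiniteMemory.admissible p)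
    (f : ℝ → (ℕ → G) → G) (hf : InfiniteMemory.IsMaximalCoupling p f)
    {Ω : Type*} [MeasurableSpace Ω] (μ : Measure Ω) [IsProbabilityMeasure μ]
    (U : ℤ → Ω → ℝ) (hU_meas : ∀ i, Measurable (U i))
    (hU_mem : ∀ i ω, U i ω ∈ Set.Ico (0 : ℝ) 1)
    (hU_unif : ∀ i, μ.map (U i) = volume.restrict (Set.Ico (0 : ℝ) 1))
    (hU_indep : iIndepFun U μ)
    (ha : 0 < InfiniteMemory.aInf p 1)
    (hi : Tendsto
      (fun N : ℕ => ∑ n ∈ Finset.Icc 1 N, ∏ m ∈ Finset.Icc 1 n, InfiniteMemory.aInf p m)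
      atTop atTop)
    (hii : ∃ s : ℕ, 0 < s ∧
      0 < μ {ω | (fun k : ℕ => U (k : ℤ) ω) ∈ InfiniteMemory.coalescence p f s}) :
    (∀ᵐ ω ∂μ, InfiniteMemory.tauZero p f (fun i => U i ω) ≠ ⊥) ∧
      InfiniteMemory.IsBackwardCoalescenceTime p f μ U g
        (fun ω => InfiniteMemory.tauZero p f (fun i => U i ω)) := by
  obtain ⟨s, hs, hs'⟩ := hii
  have hfin := InfiniteMemory.ae_tauZero_ne_bot ⟨g, hg⟩ hf hU_meas hU_unif hU_indep ha hi hs hs'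
  refine ⟨hfin, fun ω => InfiniteMemory.tauZero_nonpos _, hfin, fun l => ?_,
    fun l ω hl w hw => ?_⟩
  · refine @InfiniteMemory.measurableSet_tauZero_eq _ _ _ _ _ hf ha Ω
      (⨆ i ∈ Set.Icc (-(l : ℤ)) 0, MeasurableSpace.comap (U i) inferInstance) U _
      fun i h1 h2 => measurable_iff_comap_le.2 ?_
    exact le_iSup₂ (f := fun i (_ : i ∈ Set.Icc (-(l : ℤ)) 0) =>
      MeasurableSpace.comap (U i) inferInstance) i ⟨h1, h2⟩
  · exact InfiniteMemory.iterSucc_eq_of_mem_goodTimes (u := fun i => U i ω) hf ha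
      (fun i => (hU_mem i ω).1) (InfiniteMemory.tauZero_eq_coe_iff.1 hl).1 hw hg
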